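/- Let $A\in\mathbb C^{n\times n}$, $b\in\mathbb C^n$, let $\lambda_1,\dots,\lambda_m\in\mathbb C$ be points not lying in the spectrum $\sigma(A)$, and let $\varkappa_0,\varkappa_1,\dots,\varkappa_m$ be nonnegative integers. Let $V\in\mathbb C^{n\times\hat n}$, $\hat n\ge1$, satisfy $V^HV=\mathbf 1_{\hat n\times\hat n}$, and suppose that the vectors $$b,\,Ab,\,\dots,\,A^{\varkappa_0-1}b,\qquad (\lambda_k\mathbf 1-A)^{-1}b,\,(\lambda_k\mathbf 1-A)^{-2}b,\,\dots,\,(\lambda_k\mathbf 1-A)^{-\varkappa_k}b\quad(k=1,\dots,m)$$ form a basis of the image of $V$ (as a family: they are linearly independent and span it). Put $\widehat A=V^HAV$ and $\hat b=V^Hb$. Let $\hat\mu_1,\dots,\hat\mu_{\hat m}$ be the distinct eigenvalues of $\widehat A$ and $\hat w_1,\dots,\hat w_{\hat m}$ their algebraic multiplicities, and set $$v(\lambda)=\prod_{k=1}^{m}(\lambda-\lambda_k)^{\varkappa_k},\qquad \Omega(\lambda)=\prod_{k=1}^{\hat m}(\lambda-\hat\mu_k)^{\hat w_k},\qquad \exp_t(\lambda)=e^{\lambda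 t}.$$ Then for every $t\in\mathbb R$ the maximum below is attained and $$\bigl\lVert e^{tA}b-V e^{t\widehat A}\,\hat b\bigr\rVert\le\max_{\substack{s\in[0,1]\\ \mu\in\mathrm{co}\{\hat\mu_1,\dots,\hat\mu_{\hat m}\}}}\biggl\lVert\Omega(A)[v(A)]^{-1}\frac{(v\exp_t)^{(\hat n)}\bigl((1-s)\mu\mathbf 1+sA\bigr)}{\hat n!}\,b\biggr\rVert,$$ where $\lVert\cdot\rVert$ is the Euclidean norm on $\mathbb C^n$, $\mathrm{co}$ denotes the convex hull, $(v\exp_t)^{(\hat n)}$ is the $\hat n$-th derivative, and an entire function $f$ is applied to a square matrix $M$ by $f(M)=\frac1{2\pi i}\int_\Gamma f(\lambda)(\lambda\mathbf 1-M)^{-1}\,d\lambda$ with a contour $\Gamma$ enclosing $\sigma(M)$. -/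

import Mathlib

open scoped Matrix Real

noncomputable section

/-- The radius of a circle centred at the origin that encloses the spectrum of `M`. It is larger
than the sum of the moduli of all the entries of `M`, hence larger than any row sum. -/
def enclosingRadius {n : ℕ} (M : Matrix (Fin n) (Fin n) ℂ) : ℝ :=
  1 + ∑ i, ∑ j, ‖M i j‖

/-- Every eigenvalue of `M` lies strictly inside the circle of radius `enclosingRadius M`. -/
theorem norm_lt_enclosingRadius {n : ℕ} (M : Matrix (Fin n) (Fin n) ℂ) {z : ℂ}
    (hz : z ∈ spectrum ℂ M) : ‖z‖ < enclosingRadius M := by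
  have h1 : Module.End.HasEigenvalue (Matrix.toLin' M) z := by
    rw [Module.End.hasEigenvalue_iff_mem_spectrum, Matrix.spectrum_toLin']
    exact hz
  obtain ⟨k, hk⟩ := eigenvalue_mem_ball h1
  rw [mem_closedBall_iff_norm] at hk
  have h2 : ∑ j, ‖M k j‖ ≤ ∑ i, ∑ j, ‖M i j‖ :=
    Finset.single_le_sum (f := fun i => ∑ j, ‖M i j‖)
      (fun i _ => Finset.sum_nonneg fun j _ => norm_nonneg _) (Finset.mem_univ k)
  have h3 := Finset.add_sum_erase Finset.univ (fun j => ‖M k j‖) (Finset.mem_univ k)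
  have h4 : ‖z‖ ≤ ‖z - M k k‖ + ‖M k k‖ := by
    simpa using norm_add_le (z - M k k) (M k k)
  unfold enclosingRadius
  beta_reduce at h3
  linarith

/-- An entire function `f` applied to a square matrix `M`:
`f(M) = (2πi)⁻¹ ∮ f(z) (z 1 - M)⁻¹ dz`, the integral being taken (entrywise) along a circle that
encloses the spectrum of `M`. As `f` is entire, every contour around the spectrum gives the
same matrix. -/
def entireMatrixFunction {n : ℕ} (f : ℂ → ℂ) (M : Matrix (Fin n) (Fin n) ℂ) :
    Matrix (Fin n) (Fin n) ℂ :=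
  Matrix.of fun i j =>
    (2 * (π : ℂ) * Complex.I)⁻¹ *
      ∮ z in C(0, enclosingRadius M), f z * ((z • (1 : Matrix (Fin n) (Fin n) ℂ) - M)⁻¹ i j)

/-- The family of vectors of the one-sided rational Arnoldi method:
`A ^ j b` for `0 ≤ j < κ₀`, and `(lam k 1 - A)⁻¹ ^ j b` for each `k` and `1 ≤ j ≤ κ k`. -/
def arnoldiVectors {n m : ℕ} (A : Matrix (Fin n) (Fin n) ℂ) (b : Fin n → ℂ)
    (κ₀ : ℕ) (lam : Fin m → ℂ) (κ : Fin m → ℕ) :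
    Fin κ₀ ⊕ (Σ k : Fin m, Fin (κ k)) → (Fin n → ℂ)
  | Sum.inl j => (A ^ (j : ℕ)) *ᵥ b
  | Sum.inr ⟨k, j⟩ =>
      ((lam k • (1 : Matrix (Fin n) (Fin n) ℂ) - A)⁻¹ ^ ((j : ℕ) + 1)) *ᵥ b

/-- The polynomial `∏ k, (z - p k) ^ (w k)`. -/
def nodePolynomial {m : ℕ} (p : Fin m → ℂ) (w : Fin m → ℕ) : Polynomial ℂ :=
  ∏ k, (Polynomial.X - Polynomial.C (p k)) ^ (w k)

/-- The Euclidean norm on `ℂⁿ`. -/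
def euclNorm {n : ℕ} (x : Fin n → ℂ) : ℝ :=
  ‖(WithLp.toLp 2 x : EuclideanSpace ℂ (Fin n))‖

/-- The quantity maximised in the estimate: the Euclidean norm of
`Ω(A) v(A)⁻¹ ((v exp_t)^(N) ((1 - s) μ 1 + s A) / N!) b`, where `exp_t(z) = e ^ (t z)`. -/
def arnoldiBoundTerm {n : ℕ} (A : Matrix (Fin n) (Fin n) ℂ) (b : Fin n → ℂ)
    (Om v : Polynomial ℂ) (N : ℕ) (t s : ℝ) (μ : ℂ) : ℝ :=
  euclNorm ((Polynomial.aeval A Om * (Polynomial.aeval A v)⁻¹ *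
    (((N.factorial : ℂ)⁻¹) •
      entireMatrixFunction
        (iteratedDeriv N fun z : ℂ => v.eval z * Complex.exp ((t : ℂ) * z))
        (((1 - (s : ℂ)) * μ) • (1 : Matrix (Fin n) (Fin n) ℂ) + (s : ℂ) • A))) *ᵥ b)

end

/-! ### Contour-integral calculus for matrices -/

section MatrixFunction

open Filter Topology MeasureTheory

/-! Put `w = v(A)⁻¹ b` and `f = v exp_t`. Clearing denominators turns the rational Krylov space of
`b` into the polynomial one of `w`: the image of `V` is `{p(A) w : deg p < nhat}`
(`span_arnoldiVectors`). Since `V Vᴴ` fixes this image, `V p(Ahat) Vᴴ w = p(A) w` for such `p`.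
Moreover `e^{tA} b = f(A) w` and `e^{t Ahat} bhat = f(Ahat) Vᴴ w`.

Newton interpolation at the eigenvalues of `Ahat` gives `f = p + Ω g`, with `deg p < nhat` and `g` a
divided difference of `f`. The `p` parts cancel and `Ω(Ahat) = 0` by Cayley–Hamilton, so the error
is exactly `Ω(A) v(A)⁻¹ g(A) b`.

To bound it, nodes are removed from `g` one at a time (`DifferentiableFunctional.norm_dslope_le`).
Each removal costs one derivative of `f` and gains a factor `1 / (j + 1)`; these factors build `1 /
nhat!`. A differential inequality along segments replaces the Hermite–Genocchi integral, and
convexity keeps the base points in the hull. -/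

theorem hasSum_circleIntegral_of_summable_bound {R : ℝ} (hR : 0 ≤ R) {F : ℕ → ℂ → ℂ}
    {f : ℂ → ℂ} {u : ℕ → ℝ} (hu : Summable u)
    (hF : ∀ k, ContinuousOn (F k) (Metric.sphere 0 R))
    (hbound : ∀ k, ∀ z ∈ Metric.sphere (0 : ℂ) R, ‖F k z‖ ≤ u k)
    (hsum : ∀ z ∈ Metric.sphere (0 : ℂ) R, HasSum (fun k => F k z) (f z)) :
    HasSum (fun k => ∮ z in C(0, R), F k z) (∮ z in C(0, R), f z) := by
  have hmem := circleMap_mem_sphere (0 : ℂ) hR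
  refine intervalIntegral.hasSum_integral_of_dominated_convergence
    (fun k _ => R * u k) (fun k => ?_) (fun k => ?_) ?_ ?_ ?_
  · refine Continuous.aestronglyMeasurable ?_
    simp only [deriv_circleMap]
    exact ((continuous_circleMap 0 R).mul continuous_const).smul
      ((hF k).comp_continuous (continuous_circleMap 0 R) hmem)
  · refine Eventually.of_forall fun θ _ => ?_
    rw [norm_smul]
    simp only [deriv_circleMap, norm_mul, norm_circleMap_zero, Complex.norm_I, mul_one,
      abs_of_nonneg hR]
    exact mul_le_mul_of_nonneg_left (hbound k _ (hmem θ)) hR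
  · exact Eventually.of_forall fun θ _ => hu.mul_left R
  · exact intervalIntegrable_const
  · exact Eventually.of_forall fun θ _ => (hsum _ (hmem θ)).const_smul _

theorem hasDerivAt_circleIntegral {R : ℝ} (hR : 0 ≤ R) {H H' : ℝ → ℂ → ℂ} {y : ℂ → ℂ}
    (hH : ∀ r, Continuous (H r)) (hH' : Continuous (Function.uncurry H'))
    (hy : ContinuousOn y (Metric.sphere 0 R))
    (hderiv : ∀ r z, HasDerivAt (fun r => H r z) (H' r z) r) (r : ℝ) :
    HasDerivAt (fun r => ∮ z in C(0, R), H r z * y z) (∮ z in C(0, R), H' r z * y z) r := by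
  have hmem := circleMap_mem_sphere (0 : ℂ) hR
  have hcm := continuous_circleMap (0 : ℂ) R
  have hyc : Continuous fun θ => y (circleMap 0 R θ) := hy.comp_continuous hcm hmem
  have hd : Continuous fun θ => deriv (circleMap 0 R) θ := by
    simp only [deriv_circleMap]
    exact hcm.mul continuous_const
  have hH'c : Continuous fun p : ℝ × ℝ => H' p.1 (circleMap 0 R p.2) :=
    hH'.comp (continuous_fst.prodMk (hcm.comp continuous_snd))
  have hG : Continuous fun p : ℝ × ℝ =>
      deriv (circleMap 0 R) p.2 • (H' p.1 (circleMap 0 R p.2) * y (circleMap 0 R p.2)) :=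
    (hd.comp continuous_snd).smul (hH'c.mul (hyc.comp continuous_snd))
  -- Joint continuity bounds the derivative on a compact box; this constant is the dominating
  -- function.
  obtain ⟨K, hK⟩ := ((isCompact_Icc (a := r - 1) (b := r + 1)).prod
    (isCompact_uIcc (a := 0) (b := 2 * π))).exists_bound_of_continuousOn hG.continuousOn
  refine (intervalIntegral.hasDerivAt_integral_of_dominated_loc_of_deriv_le
    (s := Set.Icc (r - 1) (r + 1)) (bound := fun _ => K)
    (F := fun r θ => deriv (circleMap 0 R) θ • (H r (circleMap 0 R θ) * y (circleMap 0 R θ)))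
    (F' := fun r θ => deriv (circleMap 0 R) θ • (H' r (circleMap 0 R θ) * y (circleMap 0 R θ)))
    (Icc_mem_nhds (by linarith) (by linarith)) ?_ ?_ ?_ ?_ ?_ ?_).2
  · refine Eventually.of_forall fun q => Continuous.aestronglyMeasurable ?_
    exact hd.smul (((hH q).comp hcm).mul hyc)
  · exact (hd.smul (((hH r).comp hcm).mul hyc)).intervalIntegrable _ _
  · exact (hG.comp (continuous_const.prodMk continuous_id)).aestronglyMeasurable
  · exact Eventually.of_forall fun θ hθ q hq => hK (q, θ) ⟨hq, Set.uIoc_subset_uIcc hθ⟩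
  · exact intervalIntegrable_const
  · exact Eventually.of_forall fun θ _ q _ => ((hderiv q _).mul_const _).const_mul _

variable {n : ℕ}

theorem enclosingRadius_pos (M : Matrix (Fin n) (Fin n) ℂ) : 0 < enclosingRadius M := by
  unfold enclosingRadius
  positivity

theorem isUnit_smul_one_sub_of_mem_sphere (M : Matrix (Fin n) (Fin n) ℂ) {z : ℂ}
    (hz : z ∈ Metric.sphere 0 (enclosingRadius M)) :
    IsUnit (z • (1 : Matrix (Fin n) (Fin n) ℂ) - M) := by
  rw [← Algebra.algebraMap_eq_smul_one]
  refine spectrum.notMem_iff.1 fun h => ?_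
  have := norm_lt_enclosingRadius M h
  simp at hz
  linarith

theorem continuousOn_resolvent_apply (M : Matrix (Fin n) (Fin n) ℂ) (i j : Fin n) :
    ContinuousOn (fun z : ℂ => (z • (1 : Matrix (Fin n) (Fin n) ℂ) - M)⁻¹ i j)
      (Metric.sphere 0 (enclosingRadius M)) := by
  have hc : Continuous fun z : ℂ => z • (1 : Matrix (Fin n) (Fin n) ℂ) - M := by fun_prop
  simp only [Matrix.inv_def, Ring.inverse_eq_inv', Matrix.smul_apply, smul_eq_mul]
  refine ContinuousOn.mul (ContinuousOn.inv₀ hc.matrix_det.continuousOn fun z hz => ?_)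
    (hc.matrix_adjugate.matrix_elem i j).continuousOn
  exact ((Matrix.isUnit_iff_isUnit_det _).1 (isUnit_smul_one_sub_of_mem_sphere M hz)).ne_zero

theorem circleIntegrable_mul_resolvent (M : Matrix (Fin n) (Fin n) ℂ) {h : ℂ → ℂ}
    (hh : Continuous h) (i j : Fin n) :
    CircleIntegrable (fun z => h z * (z • (1 : Matrix (Fin n) (Fin n) ℂ) - M)⁻¹ i j) 0
      (enclosingRadius M) :=
  (hh.continuousOn.mul (continuousOn_resolvent_apply M i j)).circleIntegrable
    (enclosingRadius_pos M).le

theorem entireMatrixFunction_add (M : Matrix (Fin n) (Fin n) ℂ) {g h : ℂ → ℂ}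
    (hg : Continuous g) (hh : Continuous h) :
    entireMatrixFunction (fun z => g z + h z) M =
      entireMatrixFunction g M + entireMatrixFunction h M := by
  ext i j
  simp only [entireMatrixFunction, Matrix.of_apply, Matrix.add_apply, add_mul]
  rw [circleIntegral.integral_add (circleIntegrable_mul_resolvent M hg i j)
    (circleIntegrable_mul_resolvent M hh i j), mul_add]

theorem entireMatrixFunction_const_mul (M : Matrix (Fin n) (Fin n) ℂ) (c : ℂ) (h : ℂ → ℂ) :
    entireMatrixFunction (fun z => c * h z) M = c • entireMatrixFunction h M := by
  ext i j
  simp only [entireMatrixFunction, Matrix.of_apply, Matrix.smul_apply, smul_eq_mul, mul_assoc]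
  rw [circleIntegral.integral_const_mul]
  ring

theorem circleIntegral_entire_eq_zero {h : ℂ → ℂ} (hh : Differentiable ℂ h) {R : ℝ}
    (hR : 0 ≤ R) : (∮ z in C(0, R), h z) = 0 :=
  hh.diffContOnCl.circleIntegral_eq_zero hR

/-- On the circle `z (z - M)⁻¹ = 1 + M (z - M)⁻¹`, and the term `h(z) 1` integrates to zero by
Cauchy's theorem. -/
theorem entireMatrixFunction_id_mul (M : Matrix (Fin n) (Fin n) ℂ) {h : ℂ → ℂ}
    (hh : Differentiable ℂ h) :
    entireMatrixFunction (fun z => z * h z) M = M * entireMatrixFunction h M := by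
  ext i j
  have hR := (enclosingRadius_pos M).le
  have key : Set.EqOn
      (fun z : ℂ => z * h z * (z • (1 : Matrix (Fin n) (Fin n) ℂ) - M)⁻¹ i j)
      (fun z : ℂ => (1 : Matrix (Fin n) (Fin n) ℂ) i j * h z +
        ∑ k, M i k * (h z * (z • (1 : Matrix (Fin n) (Fin n) ℂ) - M)⁻¹ k j))
      (Metric.sphere 0 (enclosingRadius M)) := by
    intro z hz
    have hu := (Matrix.isUnit_iff_isUnit_det _).1 (isUnit_smul_one_sub_of_mem_sphere M hz)
    have h1 := congrFun (congrFun (Matrix.mul_nonsing_inv _ hu) i) j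
    rw [sub_mul, Matrix.smul_mul, one_mul, Matrix.sub_apply, Matrix.smul_apply,
      Matrix.mul_apply, smul_eq_mul, sub_eq_iff_eq_add] at h1
    beta_reduce
    rw [mul_right_comm, h1, add_mul, Finset.sum_mul]
    congr 1
    exact Finset.sum_congr rfl fun k _ => by ring
  simp only [entireMatrixFunction, Matrix.of_apply, Matrix.mul_apply]
  rw [circleIntegral.integral_congr hR key, circleIntegral.integral_add,
    circleIntegral.integral_const_mul, circleIntegral_entire_eq_zero hh hR,
    circleIntegral.integral_fun_sum, mul_zero, zero_add, Finset.mul_sum]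
  · refine Finset.sum_congr rfl fun k _ => ?_
    rw [circleIntegral.integral_const_mul]
    ring
  · exact fun k _ => (circleIntegrable_mul_resolvent M hh.continuous k j).const_smul (a := M i k)
  · exact (continuous_const.mul hh.continuous).continuousOn.circleIntegrable hR
  · exact CircleIntegrable.fun_sum _ fun k _ =>
      (circleIntegrable_mul_resolvent M hh.continuous k j).const_smul (a := M i k)

theorem Commute.nonsing_inv_left {M N : Matrix (Fin n) (Fin n) ℂ} (h : Commute M N) :
    Commute M⁻¹ N := by
  by_cases hM : IsUnit M
  · obtain ⟨u, rfl⟩ := hM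
    rw [← Matrix.coe_units_inv]
    exact h.units_inv_left
  -- A singular matrix has inverse `0` by convention.
  · rw [Matrix.nonsing_inv_apply_not_isUnit _ fun h => hM ((Matrix.isUnit_iff_isUnit_det _).2 h)]
    exact Commute.zero_left N

theorem entireMatrixFunction_commute (M N : Matrix (Fin n) (Fin n) ℂ) (hMN : Commute M N)
    {h : ℂ → ℂ} (hh : Continuous h) : Commute (entireMatrixFunction h M) N := by
  have hR := (enclosingRadius_pos M).le
  ext i j
  simp only [entireMatrixFunction, Matrix.of_apply, Matrix.mul_apply]
  have hl : ∀ k, (2 * (π : ℂ) * Complex.I)⁻¹ * (∮ z in C(0, enclosingRadius M),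
        h z * (z • (1 : Matrix (Fin n) (Fin n) ℂ) - M)⁻¹ i k) * N k j =
      (2 * (π : ℂ) * Complex.I)⁻¹ * (∮ z in C(0, enclosingRadius M),
        N k j * (h z * (z • (1 : Matrix (Fin n) (Fin n) ℂ) - M)⁻¹ i k)) := fun k => by
    rw [circleIntegral.integral_const_mul]
    ring
  have hr : ∀ k, N i k * ((2 * (π : ℂ) * Complex.I)⁻¹ * (∮ z in C(0, enclosingRadius M),
        h z * (z • (1 : Matrix (Fin n) (Fin n) ℂ) - M)⁻¹ k j)) =
      (2 * (π : ℂ) * Complex.I)⁻¹ * (∮ z in C(0, enclosingRadius M),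
        N i k * (h z * (z • (1 : Matrix (Fin n) (Fin n) ℂ) - M)⁻¹ k j)) := fun k => by
    rw [circleIntegral.integral_const_mul]
    ring
  simp only [hl, hr, ← Finset.mul_sum]
  rw [← circleIntegral.integral_fun_sum, ← circleIntegral.integral_fun_sum]
  · congr 1
    refine circleIntegral.integral_congr hR fun z hz => ?_
    have hc : Commute (z • (1 : Matrix (Fin n) (Fin n) ℂ) - M)⁻¹ N := by
      exact Commute.nonsing_inv_left (((Commute.one_left N).smul_left z).sub_left hMN)
    have h1 := congrFun (congrFun hc.eq i) j
    rw [Matrix.mul_apply, Matrix.mul_apply] at h1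
    calc ∑ k, N k j * (h z * (z • (1 : Matrix (Fin n) (Fin n) ℂ) - M)⁻¹ i k)
        = h z * ∑ k, (z • (1 : Matrix (Fin n) (Fin n) ℂ) - M)⁻¹ i k * N k j := by
          rw [Finset.mul_sum]
          exact Finset.sum_congr rfl fun k _ => by ring
      _ = ∑ k, N i k * (h z * (z • (1 : Matrix (Fin n) (Fin n) ℂ) - M)⁻¹ k j) := by
          rw [h1, Finset.mul_sum]
          exact Finset.sum_congr rfl fun k _ => by ring
  · exact fun k _ => (circleIntegrable_mul_resolvent M hh k j).const_smul (a := N i k)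
  · exact fun k _ => (circleIntegrable_mul_resolvent M hh i k).const_smul (a := N k j)

theorem entireMatrixFunction_polynomial_mul (M : Matrix (Fin n) (Fin n) ℂ) (p : Polynomial ℂ)
    {h : ℂ → ℂ} (hh : Differentiable ℂ h) :
    entireMatrixFunction (fun z => p.eval z * h z) M =
      Polynomial.aeval M p * entireMatrixFunction h M := by
  induction p using Polynomial.induction_on' with
  | add p q hp hq =>
    have := entireMatrixFunction_add M (g := fun z => p.eval z * h z)
      (h := fun z => q.eval z * h z) (p.continuous.mul hh.continuous)
      (q.continuous.mul hh.continuous)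
    simp only [Polynomial.eval_add, add_mul, map_add]
    rw [this, hp, hq]
  | monomial k a =>
    rw [← mul_one a, ← smul_eq_mul, ← Polynomial.smul_monomial,
      Polynomial.monomial_one_right_eq_X_pow]
    simp only [Polynomial.eval_smul, Polynomial.eval_pow, Polynomial.eval_X, map_smul, map_pow,
      Polynomial.aeval_X, smul_eq_mul, Matrix.smul_mul, mul_assoc,
      entireMatrixFunction_const_mul]
    congr 1
    induction k with
    | zero => simp
    | succ k ih =>
      simp only [pow_succ', mul_assoc]
      rw [entireMatrixFunction_id_mul M (h := fun z => z ^ k * h z)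
        ((differentiable_id.pow k).mul hh), ih]

theorem norm_pow_apply_le (M : Matrix (Fin n) (Fin n) ℂ) (k : ℕ) (i j : Fin n) :
    ‖(M ^ k) i j‖ ≤ (∑ i, ∑ j, ‖M i j‖) ^ k := by
  induction k generalizing j with
  | zero => rw [pow_zero, pow_zero, Matrix.one_apply]; split_ifs <;> simp
  | succ k ih =>
    rw [pow_succ, Matrix.mul_apply, pow_succ]
    calc ‖∑ l, (M ^ k) i l * M l j‖ ≤ ∑ l, ‖(M ^ k) i l * M l j‖ := norm_sum_le _ _
      _ ≤ ∑ l, (∑ i, ∑ j, ‖M i j‖) ^ k * ∑ j, ‖M l j‖ := by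
          refine Finset.sum_le_sum fun l _ => ?_
          rw [norm_mul]
          exact mul_le_mul (ih l) (Finset.single_le_sum (f := fun j => ‖M l j‖)
            (fun _ _ => norm_nonneg _) (Finset.mem_univ j)) (norm_nonneg _) (by positivity)
      _ = _ := by rw [← Finset.mul_sum]

open scoped Matrix.Norms.Operator in
theorem hasSum_resolvent_apply (M : Matrix (Fin n) (Fin n) ℂ) {z : ℂ}
    (hz : z ∈ Metric.sphere 0 (enclosingRadius M)) (i j : Fin n) :
    HasSum (fun k : ℕ => (M ^ k) i j * (z ^ (k + 1))⁻¹)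
      ((z • (1 : Matrix (Fin n) (Fin n) ℂ) - M)⁻¹ i j) := by
  have hz' : ‖z‖ = enclosingRadius M := by simpa using hz
  have hz0 : z ≠ 0 := norm_pos_iff.1 (hz' ▸ enclosingRadius_pos M)
  -- The radius exceeds the maximal row sum, which is the operator norm in scope, so the Neumann
  -- series converges.
  have hM : ‖M‖ < ‖z‖ := by
    rw [Matrix.linfty_opNorm_def, hz', enclosingRadius, ← NNReal.coe_one]
    have : (Finset.univ.sup fun i => ∑ j, ‖M i j‖₊) ≤ ∑ i, ∑ j, ‖M i j‖₊ :=
      Finset.sup_le fun i hi =>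
        Finset.single_le_sum (f := fun i => ∑ j, ‖M i j‖₊) (fun _ _ => zero_le) hi
    have := NNReal.coe_le_coe.2 this
    push_cast at this ⊢
    linarith
  have hlt : ‖z⁻¹ • M‖ < 1 := by
    rw [norm_smul, norm_inv, inv_mul_lt_iff₀ (norm_pos_iff.2 hz0), mul_one]
    exact hM
  have hs : HasSum (fun k : ℕ => (z⁻¹ • M) ^ k) (Ring.inverse (1 - z⁻¹ • M)) := by
    rw [← geom_series_eq_inverse _ hlt]
    exact (summable_geometric_of_norm_lt_one hlt).hasSum
  have hinv : (z • (1 : Matrix (Fin n) (Fin n) ℂ) - M)⁻¹ = z⁻¹ • Ring.inverse (1 - z⁻¹ • M) := by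
    rw [← Matrix.nonsing_inv_eq_ringInverse]
    have hu := (Matrix.isUnit_iff_isUnit_det _).1 (isUnit_smul_one_sub_of_mem_sphere M hz)
    have he : z • (1 : Matrix (Fin n) (Fin n) ℂ) - M = z • (1 - z⁻¹ • M) := by
      rw [smul_sub, smul_smul, mul_inv_cancel₀ hz0, one_smul]
    have hu' : IsUnit (1 - z⁻¹ • M).det := by
      rw [he, Matrix.det_smul] at hu
      exact isUnit_of_mul_isUnit_right hu
    refine Matrix.inv_eq_right_inv ?_
    rw [he, Matrix.smul_mul, Matrix.mul_smul, smul_smul, mul_inv_cancel₀ hz0, one_smul,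
      Matrix.mul_nonsing_inv _ hu']
  have h2 := Pi.hasSum.1 (Pi.hasSum.1 (hs.const_smul z⁻¹) i) j
  rw [hinv]
  refine h2.congr_fun ?_
  intro k
  simp only [smul_pow, Matrix.smul_apply, smul_eq_mul, pow_succ, mul_inv, inv_pow]
  ring

/-- Integrate the Neumann series termwise: only the `z⁻¹` term has a nonzero integral. -/
theorem entireMatrixFunction_one (M : Matrix (Fin n) (Fin n) ℂ) :
    entireMatrixFunction (fun _ => 1) M = 1 := by
  ext i j
  have hR := enclosingRadius_pos M
  set S := ∑ i, ∑ j, ‖M i j‖ with hS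
  have hS0 : 0 ≤ S := by positivity
  have hRS : enclosingRadius M = 1 + S := rfl
  have hne : ∀ z ∈ Metric.sphere (0 : ℂ) (enclosingRadius M), z ≠ 0 := by
    rintro z hz rfl
    simp at hz
    linarith
  have hsum := hasSum_circleIntegral_of_summable_bound hR.le
    (F := fun k z => (M ^ k) i j * (z ^ (k + 1))⁻¹)
    (f := fun z => (z • (1 : Matrix (Fin n) (Fin n) ℂ) - M)⁻¹ i j)
    (u := fun k => (S / enclosingRadius M) ^ k * (enclosingRadius M)⁻¹)
    ((summable_geometric_of_lt_one (by positivity)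
      ((div_lt_one hR).2 (by linarith))).mul_right _)
    (fun k => continuousOn_const.mul
      ((continuous_pow _).continuousOn.inv₀ fun z hz => pow_ne_zero _ (hne z hz)))
    (fun k z hz => by
      have hz' : ‖z‖ = enclosingRadius M := by simpa using hz
      rw [norm_mul, norm_inv, norm_pow, hz', div_pow, pow_succ, mul_inv, ← mul_assoc,
        div_eq_mul_inv]
      gcongr
      exact norm_pow_apply_le M k i j)
    (fun z hz => hasSum_resolvent_apply M hz i j)
  have hterm : ∀ k : ℕ, k ≠ 0 →
      (∮ z in C(0, enclosingRadius M), (M ^ k) i j * (z ^ (k + 1))⁻¹) = 0 := fun k hk => by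
    rw [circleIntegral.integral_const_mul]
    have := circleIntegral.integral_sub_zpow_of_ne (n := -((k : ℤ) + 1)) (by omega) 0 0
      (enclosingRadius M)
    have h2 : ∀ z : ℂ, (z - 0) ^ (-((k : ℤ) + 1)) = (z ^ (k + 1))⁻¹ := fun z => by
      rw [sub_zero, zpow_neg]
      norm_cast
    simp only [h2] at this
    rw [this, mul_zero]
  have h0 := hsum.unique (hasSum_single 0 hterm)
  simp only [entireMatrixFunction, Matrix.of_apply, one_mul]
  rw [h0, pow_zero, circleIntegral.integral_const_mul]
  have h3 := circleIntegral.integral_sub_center_inv 0 hR.ne'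
  simp only [sub_zero] at h3
  simp only [zero_add, pow_one]
  rw [h3]
  have := Complex.two_pi_I_ne_zero
  field_simp

theorem entireMatrixFunction_polynomial (M : Matrix (Fin n) (Fin n) ℂ) (p : Polynomial ℂ) :
    entireMatrixFunction (fun z => p.eval z) M = Polynomial.aeval M p := by
  have := entireMatrixFunction_polynomial_mul M p (differentiable_const (1 : ℂ))
  simpa [entireMatrixFunction_one] using this

open scoped Matrix.Norms.Operator in
theorem hasSum_exp_apply (M : Matrix (Fin n) (Fin n) ℂ) (i j : Fin n) :
    HasSum (fun k : ℕ => (k.factorial : ℂ)⁻¹ * (M ^ k) i j) (NormedSpace.exp M i j) :=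
  Pi.hasSum.1 (Pi.hasSum.1 (NormedSpace.exp_series_hasSum_exp' (𝕂 := ℂ) M) i) j

/-- Expand the scalar exponential under the integral; each term is a monomial, already identified
with its algebraic value, and the sum is the matrix exponential series. -/
theorem entireMatrixFunction_exp (M : Matrix (Fin n) (Fin n) ℂ) (t : ℂ) :
    entireMatrixFunction (fun z => Complex.exp (t * z)) M = NormedSpace.exp (t • M) := by
  ext i j
  have hR := enclosingRadius_pos M
  obtain ⟨K, hK⟩ := (isCompact_sphere (0 : ℂ) (enclosingRadius M)).exists_bound_of_continuousOn
    (continuousOn_resolvent_apply M i j)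
  have hsum := hasSum_circleIntegral_of_summable_bound hR.le
    (F := fun k z => (Polynomial.C ((k.factorial : ℂ)⁻¹ * t ^ k) * Polynomial.X ^ k).eval z *
      (z • (1 : Matrix (Fin n) (Fin n) ℂ) - M)⁻¹ i j)
    (f := fun z => Complex.exp (t * z) * (z • (1 : Matrix (Fin n) (Fin n) ℂ) - M)⁻¹ i j)
    (u := fun k => (‖t‖ * enclosingRadius M) ^ k / k.factorial * K)
    ((Real.summable_pow_div_factorial _).mul_right _)
    (fun k => (Polynomial.continuous _).continuousOn.mul (continuousOn_resolvent_apply M i j))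
    (fun k z hz => by
      have hz' : ‖z‖ = enclosingRadius M := by simpa using hz
      simp only [Polynomial.eval_mul, Polynomial.eval_C, Polynomial.eval_pow, Polynomial.eval_X]
      rw [norm_mul]
      refine mul_le_mul (le_of_eq ?_) (hK z hz) (norm_nonneg _) (by positivity)
      simp only [norm_mul, norm_inv, norm_pow, hz', Complex.norm_natCast, mul_pow]
      ring)
    (fun z hz => by
      refine HasSum.mul_right _ ?_
      have := NormedSpace.expSeries_div_hasSum_exp (t * z)
      rw [← Complex.exp_eq_exp_ℂ] at this
      refine this.congr_fun fun k => ?_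
      simp only [Polynomial.eval_mul, Polynomial.eval_C, Polynomial.eval_pow, Polynomial.eval_X,
        mul_pow]
      ring)
  refine (hsum.mul_left (2 * (π : ℂ) * Complex.I)⁻¹).unique ?_
  refine (hasSum_exp_apply (t • M) i j).congr_fun fun k => ?_
  have := congrFun (congrFun (entireMatrixFunction_polynomial M
    (Polynomial.C ((k.factorial : ℂ)⁻¹ * t ^ k) * Polynomial.X ^ k)) i) j
  simp only [entireMatrixFunction, Matrix.of_apply] at this
  rw [this]
  simp [Algebra.algebraMap_eq_smul_one, smul_pow, mul_assoc, mul_left_comm]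

theorem entireMatrixFunction_polynomial_mul_exp (M : Matrix (Fin n) (Fin n) ℂ)
    (p : Polynomial ℂ) (t : ℂ) :
    entireMatrixFunction (fun z => p.eval z * Complex.exp (t * z)) M =
      Polynomial.aeval M p * NormedSpace.exp (t • M) := by
  rw [entireMatrixFunction_polynomial_mul M p (by fun_prop), entireMatrixFunction_exp]

theorem hasDerivAt_entireMatrixFunction_apply (M : Matrix (Fin n) (Fin n) ℂ)
    {H H' : ℝ → ℂ → ℂ} (hH : ∀ r, Continuous (H r)) (hH' : Continuous (Function.uncurry H'))
    (hderiv : ∀ r z, HasDerivAt (fun r => H r z) (H' r z) r) (r : ℝ) (i j : Fin n) :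
    HasDerivAt (fun r => entireMatrixFunction (H r) M i j)
      (entireMatrixFunction (H' r) M i j) r :=
  (hasDerivAt_circleIntegral (enclosingRadius_pos M).le hH hH'
    (continuousOn_resolvent_apply M i j) hderiv r).const_mul _

end MatrixFunction

/-! ### Divided differences and their bound -/

section DividedDifference

theorem Differentiable.dslope {f : ℂ → ℂ} (hf : Differentiable ℂ f) (c : ℂ) :
    Differentiable ℂ (dslope f c) := by
  rw [← differentiableOn_univ] at hf ⊢
  exact (Complex.differentiableOn_dslope Filter.univ_mem).2 hf

theorem Differentiable.iteratedDeriv {f : ℂ → ℂ} (hf : Differentiable ℂ f) (j : ℕ) :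
    Differentiable ℂ (iteratedDeriv j f) :=
  (hf.contDiff (n := (j + 1 : ℕ))).differentiable_iteratedDeriv j
    (by exact_mod_cast j.lt_succ_self)

theorem Differentiable.hasDerivAt_iteratedDeriv {f : ℂ → ℂ} (hf : Differentiable ℂ f) (j : ℕ)
    (z : ℂ) : HasDerivAt (_root_.iteratedDeriv j f) (_root_.iteratedDeriv (j + 1) f z) z := by
  rw [iteratedDeriv_succ]
  exact (hf.iteratedDeriv j z).hasDerivAt

/-- Leibniz's rule for `f z - f c = (z - c) * dslope f c z`: the factor `z - c` has only one nonzero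
derivative. -/
theorem sub_mul_iteratedDeriv_dslope {f : ℂ → ℂ} (hf : Differentiable ℂ f) (c : ℂ) (j : ℕ)
    (z : ℂ) :
    (z - c) * iteratedDeriv (j + 1) (dslope f c) z + (j + 1) * iteratedDeriv j (dslope f c) z =
      iteratedDeriv (j + 1) f z := by
  have hg := hf.dslope c
  have hlin : ∀ z, HasDerivAt (fun z : ℂ => z - c) 1 z := fun z => (hasDerivAt_id z).sub_const c
  induction j generalizing z with
  | zero =>
    have h1 := (hlin z).mul (hg.hasDerivAt_iteratedDeriv 0 z)
    have h2 : ((fun z : ℂ => z - c) * iteratedDeriv 0 (dslope f c)) = fun z => f z - f c := by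
      ext z
      rw [iteratedDeriv_zero, ← sub_smul_dslope f c z]
      rfl
    rw [h2] at h1
    have h3 := h1.unique ((hf.hasDerivAt_iteratedDeriv 0 z).sub_const (f c))
    rw [← h3]
    push_cast
    ring
  | succ j ih =>
    have h1 := ((hlin z).mul (hg.hasDerivAt_iteratedDeriv (j + 1) z)).add
      ((hg.hasDerivAt_iteratedDeriv j z).const_mul ((j : ℂ) + 1))
    have h2 : ((fun z : ℂ => z - c) * iteratedDeriv (j + 1) (dslope f c) +
        fun z => ((j : ℂ) + 1) * iteratedDeriv j (dslope f c) z) = iteratedDeriv (j + 1) f :=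
      funext ih
    rw [h2] at h1
    rw [← h1.unique (hf.hasDerivAt_iteratedDeriv (j + 1) z)]
    push_cast
    ring

/-- The divided difference `z ↦ f[c₁, …, c_k, z]` with respect to a list of nodes. -/
noncomputable def dividedDifference (f : ℂ → ℂ) : List ℂ → ℂ → ℂ
  | [] => f
  | c :: l => dividedDifference (dslope f c) l

theorem Differentiable.dividedDifference {f : ℂ → ℂ} (hf : Differentiable ℂ f) (l : List ℂ) :
    Differentiable ℂ (dividedDifference f l) := by
  induction l generalizing f with
  | nil => exact hf
  | cons c l ih => exact ih (hf.dslope c)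

/-- Newton's interpolation formula with remainder. -/
theorem exists_interpolation (f : ℂ → ℂ) (l : List ℂ) :
    ∃ p : Polynomial ℂ, p.degree < l.length ∧ ∀ z, f z =
      p.eval z + (l.map fun c => Polynomial.X - Polynomial.C c).prod.eval z *
        dividedDifference f l z := by
  induction l generalizing f with
  | nil => exact ⟨0, by simp, fun z => by simp [dividedDifference]⟩
  | cons c l ih =>
    obtain ⟨p, hp, hpf⟩ := ih (dslope f c)
    refine ⟨Polynomial.C (f c) + (Polynomial.X - Polynomial.C c) * p, ?_, fun z => ?_⟩
    · refine (Polynomial.degree_add_le _ _).trans_lt (max_lt ?_ ?_)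
      · exact Polynomial.degree_C_le.trans_lt (by simp; positivity)
      · rw [Polynomial.degree_mul, Polynomial.degree_X_sub_C, add_comm]
        by_cases h0 : p = 0
        · simp only [h0, Polynomial.degree_zero, WithBot.bot_add]
          exact WithBot.bot_lt_coe _
        · rw [Polynomial.degree_eq_natDegree h0] at hp ⊢
          have : p.natDegree < l.length := by exact_mod_cast hp
          rw [List.length_cons]
          exact_mod_cast Nat.succ_lt_succ this
    · have h1 := sub_smul_dslope f c z
      rw [hpf z, smul_eq_mul] at h1
      simp only [Polynomial.eval_add, Polynomial.eval_C, Polynomial.eval_mul, Polynomial.eval_sub,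
        Polynomial.eval_X, List.map_cons, List.prod_cons, dividedDifference]
      linear_combination -h1

/-- A linear functional on entire functions with values in a normed space that may be
differentiated with respect to a parameter. -/
structure DifferentiableFunctional (E : Type*) [NormedAddCommGroup E] [NormedSpace ℂ E] where
  toFun : (ℂ → ℂ) → E
  map_const_mul : ∀ (c : ℂ) (h : ℂ → ℂ), toFun (fun z => c * h z) = c • toFun h
  hasDerivAt : ∀ {H H' : ℝ → ℂ → ℂ}, (∀ r, Continuous (H r)) →
    Continuous (Function.uncurry H') → (∀ r z, HasDerivAt (fun r => H r z) (H' r z) r) →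
    ∀ r, HasDerivAt (fun r => toFun (H r)) (toFun (H' r)) r

variable {E : Type*} [NormedAddCommGroup E] [NormedSpace ℂ E]

/-- With `g = dslope f c` and `y r` running from `c` to the given argument, `r^(j+1) g^(j)(y r)` has
`r`-derivative `r^j f^(j+1)(y r)`. After applying `T` its norm is at most `C r^j`; comparison with
`C r^(j+1) / (j+1)` at `r = 1` gives the claim. -/
theorem DifferentiableFunctional.norm_dslope_le (T : DifferentiableFunctional E) {K : Set ℂ}
    (hK : Convex ℝ K) {f : ℂ → ℂ} (hf : Differentiable ℂ f) {c : ℂ} (hc : c ∈ K) (j : ℕ) {C : ℝ}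
    (hC : ∀ s ∈ Set.Icc (0 : ℝ) 1, ∀ μ ∈ K,
      ‖T.toFun (fun z => iteratedDeriv (j + 1) f ((1 - s) * μ + s * z))‖ ≤ C)
    {s : ℝ} (hs : s ∈ Set.Icc (0 : ℝ) 1) {μ : ℂ} (hμ : μ ∈ K) :
    ‖T.toFun (fun z => iteratedDeriv j (dslope f c) ((1 - s) * μ + s * z))‖ ≤ C / (j + 1) := by
  have hg := hf.dslope c
  set e : ℂ → ℂ := fun z => (1 - s) * μ + s * z with he
  have hec : Continuous e := by fun_prop
  let y : ℝ → ℂ → ℂ := fun r z => c + r * (e z - c)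
  have hy : Continuous (Function.uncurry y) := by
    simp only [y, Function.uncurry_def]
    fun_prop
  let H : ℝ → ℂ → ℂ := fun r z => (r : ℂ) ^ (j + 1) * iteratedDeriv j (dslope f c) (y r z)
  let H' : ℝ → ℂ → ℂ := fun r z => (r : ℂ) ^ j * iteratedDeriv (j + 1) f (y r z)
  have hderiv : ∀ r z, HasDerivAt (fun r => H r z) (H' r z) r := by
    intro r z
    have h1 : HasDerivAt (fun r : ℝ => (r : ℂ)) 1 r := Complex.ofRealCLM.hasDerivAt
    have h2 : HasDerivAt (fun r : ℝ => y r z) (e z - c) r := 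
      ((h1.mul_const (e z - c)).const_add c).congr_deriv (one_mul _)
    have h3 := (h1.pow (j + 1)).mul ((hg.hasDerivAt_iteratedDeriv j (y r z)).comp r h2)
    refine h3.congr_deriv ?_
    have h4 := sub_mul_iteratedDeriv_dslope hf c j (y r z)
    have h5 : y r z - c = r * (e z - c) := by simp [y]
    rw [h5] at h4
    simp only [H', ← h4, Function.comp_apply, Pi.pow_apply, Nat.add_sub_cancel]
    push_cast
    ring
  have hH : ∀ r, Continuous (H r) := fun r =>
    continuous_const.mul ((hg.iteratedDeriv j).continuous.comp
      (hy.comp (continuous_const.prodMk continuous_id)))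
  have hH' : Continuous (Function.uncurry H') :=
    ((Complex.continuous_ofReal.comp continuous_fst).pow j).mul
      ((hf.iteratedDeriv (j + 1)).continuous.comp hy)
  have hT := T.hasDerivAt hH hH' hderiv
  have hbound : ∀ r ∈ Set.Ico (0 : ℝ) 1, ‖T.toFun (H' r)‖ ≤ C * r ^ j := by
    intro r hr
    have hsr : 0 ≤ r * s ∧ r * s < 1 :=
      ⟨mul_nonneg hr.1 hs.1, (mul_le_of_le_one_right hr.1 hs.2).trans_lt hr.2⟩
    have hpos : 0 < 1 - r * s := by linarith
    -- The point `y r z` equals `(1 - rs) μ' + rs z` with this `μ'`, so the hypothesis applies with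
    -- `rs` in place of `s`; `r < 1` keeps the denominator positive.
    have hmem : ((1 - r) / (1 - r * s)) • c + (r * (1 - s) / (1 - r * s)) • μ ∈ K := by
      refine hK hc hμ (div_nonneg (by linarith [hr.2]) hpos.le)
        (div_nonneg (mul_nonneg hr.1 (by linarith [hs.2])) hpos.le) ?_
      field_simp
      ring
    have h1 := hC (r * s) ⟨hsr.1, hsr.2.le⟩ _ hmem
    have h2 : T.toFun (H' r) = (r : ℂ) ^ j • T.toFun (fun z => iteratedDeriv (j + 1) f
        ((1 - (r * s : ℝ)) * (((1 - r) / (1 - r * s)) • c + (r * (1 - s) / (1 - r * s)) • μ) +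
          (r * s : ℝ) * z)) := by
      rw [← T.map_const_mul]
      congr 1
      ext z
      have hne : (1 - r * s : ℂ) ≠ 0 := by exact_mod_cast hpos.ne'
      simp only [H', y, he, Complex.real_smul]
      congr 2
      push_cast
      field_simp
      ring
    rw [h2, norm_smul, norm_pow, Complex.norm_real, Real.norm_of_nonneg hr.1, mul_comm]
    exact mul_le_mul_of_nonneg_right h1 (pow_nonneg hr.1 j)
  have hB : ∀ r : ℝ, HasDerivAt (fun r : ℝ => C / (j + 1) * r ^ (j + 1)) (C * r ^ j) r := by
    intro r
    refine ((hasDerivAt_pow (j + 1) r).const_mul (C / (j + 1))).congr_deriv ?_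
    push_cast
    field_simp
  -- Homogeneity with scalar `0` suffices, as `H 0` vanishes identically.
  have h0 : T.toFun (H 0) = 0 := by
    have : H 0 = fun z => 0 * H 0 z := by
      ext z
      simp [H]
    rw [this, T.map_const_mul, zero_smul]
  have hfin := image_norm_le_of_norm_deriv_right_le_deriv_boundary (a := 0) (b := 1)
    (f := fun r => T.toFun (H r)) (fun r _ => (hT r).continuousAt.continuousWithinAt)
    (fun r _ => (hT r).hasDerivWithinAt) (by simp [h0]) hB hbound (Set.right_mem_Icc.2 zero_le_one)
  simpa [H, y] using hfin

theorem DifferentiableFunctional.norm_iteratedDeriv_dividedDifference_le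
    (T : DifferentiableFunctional E) {K : Set ℂ} (hK : Convex ℝ K) (l : List ℂ)
    (hl : ∀ c ∈ l, c ∈ K) {f : ℂ → ℂ} (hf : Differentiable ℂ f) (j : ℕ) {C : ℝ}
    (hC : ∀ s ∈ Set.Icc (0 : ℝ) 1, ∀ μ ∈ K,
      ‖T.toFun (fun z => iteratedDeriv (l.length + j) f ((1 - s) * μ + s * z))‖ ≤ C)
    {s : ℝ} (hs : s ∈ Set.Icc (0 : ℝ) 1) {μ : ℂ} (hμ : μ ∈ K) :
    ‖T.toFun (fun z => iteratedDeriv j (dividedDifference f l) ((1 - s) * μ + s * z))‖ ≤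
      C * j.factorial / (l.length + j).factorial := by
  induction l generalizing f C with
  | nil =>
    have := hC s hs μ hμ
    simp only [List.length_nil, zero_add] at this ⊢
    rwa [mul_div_cancel_right₀ _ (Nat.cast_ne_zero.2 j.factorial_ne_zero)]
  | cons c l ih =>
    have hlen : (c :: l).length + j = l.length + j + 1 := by
      rw [List.length_cons]
      ring
    rw [hlen] at hC ⊢
    have h1 := ih (fun d hd => hl d (List.mem_cons_of_mem c hd)) (hf.dslope c)
      fun s hs μ hμ => T.norm_dslope_le hK hf (hl c List.mem_cons_self) (l.length + j) hC hs hμ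
    refine h1.trans (le_of_eq ?_)
    rw [Nat.factorial_succ]
    push_cast
    field_simp

theorem DifferentiableFunctional.norm_dividedDifference_le
    (T : DifferentiableFunctional E) {K : Set ℂ} (hK : Convex ℝ K) (hne : K.Nonempty)
    (l : List ℂ) (hl : ∀ c ∈ l, c ∈ K) {f : ℂ → ℂ} (hf : Differentiable ℂ f) {C : ℝ}
    (hC : ∀ s ∈ Set.Icc (0 : ℝ) 1, ∀ μ ∈ K,
      ‖T.toFun (fun z => iteratedDeriv l.length f ((1 - s) * μ + s * z))‖ ≤ C) :
    ‖T.toFun (dividedDifference f l)‖ ≤ C / l.length.factorial := by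
  obtain ⟨μ, hμ⟩ := hne
  -- At `s = 1` the argument is `z` itself, whatever `μ` is.
  simpa using T.norm_iteratedDeriv_dividedDifference_le hK l hl hf 0 hC
    (Set.right_mem_Icc.2 zero_le_one) hμ

end DividedDifference

/-! ### Rational Krylov spaces and compression by `V` -/

section RationalKrylov

open Polynomial

variable {n m N : ℕ}

theorem nodePolynomial_monic (p : Fin m → ℂ) (w : Fin m → ℕ) : (nodePolynomial p w).Monic :=
  monic_prod_of_monic _ _ fun k _ => (monic_X_sub_C (p k)).pow (w k)

theorem natDegree_nodePolynomial (p : Fin m → ℂ) (w : Fin m → ℕ) :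
    (nodePolynomial p w).natDegree = ∑ k, w k := by
  rw [nodePolynomial, natDegree_prod_of_monic _ _ fun k _ => (monic_X_sub_C (p k)).pow (w k)]
  simp

theorem isUnit_aeval_nodePolynomial (A : Matrix (Fin n) (Fin n) ℂ) (p : Fin m → ℂ)
    (w : Fin m → ℕ) (hp : ∀ k, p k ∉ spectrum ℂ A) : IsUnit (aeval A (nodePolynomial p w)) := by
  refine Finset.prod_induction _ (fun q => IsUnit (aeval A q)) (fun q r hq hr => ?_) ?_
    fun k _ => ?_
  · rw [map_mul]
    exact hq.mul hr
  · rw [map_one]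
    exact isUnit_one
  · have h := (spectrum.notMem_iff.1 (hp k)).neg
    rw [map_pow, map_sub, aeval_X, aeval_C]
    rw [neg_sub] at h
    exact h.pow _

/-- Evaluation of a polynomial at a matrix, applied to a vector. -/
noncomputable def krylovMap (A : Matrix (Fin n) (Fin n) ℂ) (w : Fin n → ℂ) : ℂ[X] →ₗ[ℂ] (Fin n → ℂ) where
  toFun p := aeval A p *ᵥ w
  map_add' p q := by rw [map_add, Matrix.add_mulVec]
  map_smul' c p := by rw [map_smul, Matrix.smul_mulVec, RingHom.id_apply]

/-- For `b = v(A) w` the vectors come from the polynomials `X^j v` and `v / (lam k - X)^(j+1)`. -/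
theorem arnoldiVectors_mem_krylov (A : Matrix (Fin n) (Fin n) ℂ) (w : Fin n → ℂ) (κ₀ : ℕ)
    (lam : Fin m → ℂ) (κ : Fin m → ℕ) (hlam : ∀ k, lam k ∉ spectrum ℂ A)
    (i : Fin κ₀ ⊕ (Σ k : Fin m, Fin (κ k))) :
    arnoldiVectors A (aeval A (nodePolynomial lam κ) *ᵥ w) κ₀ lam κ i ∈
      (degreeLT ℂ (κ₀ + ∑ k, κ k)).map (krylovMap A w) := by
  have hv := nodePolynomial_monic lam κ
  have hdeg := natDegree_nodePolynomial lam κ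
  rcases i with j | ⟨k, j⟩
  · refine ⟨X ^ (j : ℕ) * nodePolynomial lam κ, ?_, ?_⟩
    · rw [SetLike.mem_coe, mem_degreeLT, degree_mul, degree_X_pow,
        degree_eq_natDegree hv.ne_zero, hdeg]
      have := j.2
      exact_mod_cast by omega
    · simp [krylovMap, arnoldiVectors, Matrix.mulVec_mulVec]
  · have hdvd : (C (lam k) - X) ^ ((j : ℕ) + 1) ∣ nodePolynomial lam κ := by
      have h1 : (X - C (lam k)) ^ (κ k) ∣ nodePolynomial lam κ :=
        Finset.dvd_prod_of_mem (fun k => (X - C (lam k)) ^ (κ k)) (Finset.mem_univ k)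
      refine ((pow_dvd_pow_of_dvd ?_ _).trans (pow_dvd_pow _ j.2)).trans h1
      rw [← neg_sub, neg_dvd]
    obtain ⟨u, hu⟩ := hdvd
    have hne : C (lam k) - X ≠ 0 := by
      rw [← neg_sub, neg_ne_zero]
      exact X_sub_C_ne_zero _
    have hu0 : u ≠ 0 := by
      rintro rfl
      exact hv.ne_zero (by rw [hu, mul_zero])
    refine ⟨u, ?_, ?_⟩
    · rw [SetLike.mem_coe, mem_degreeLT, degree_eq_natDegree hu0]
      rw [hu, natDegree_mul (pow_ne_zero _ hne) hu0, natDegree_pow, ← neg_sub, natDegree_neg,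
        natDegree_X_sub_C] at hdeg
      exact_mod_cast by omega
    · have hunit : IsUnit (lam k • (1 : Matrix (Fin n) (Fin n) ℂ) - A) := by
        rw [← Algebra.algebraMap_eq_smul_one]
        exact spectrum.notMem_iff.1 (hlam k)
      have hdet := (Matrix.isUnit_iff_isUnit_det _).1 (hunit.pow ((j : ℕ) + 1))
      simp only [krylovMap, arnoldiVectors, LinearMap.coe_mk, AddHom.coe_mk]
      rw [hu, map_mul, map_pow, map_sub, aeval_X, aeval_C, Algebra.algebraMap_eq_smul_one,
        Matrix.mulVec_mulVec, ← mul_assoc, Matrix.inv_pow', Matrix.nonsing_inv_mul _ hdet,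
        one_mul]

theorem finrank_degreeLT_map_le (A : Matrix (Fin n) (Fin n) ℂ) (w : Fin n → ℂ) (d : ℕ) :
    Module.finrank ℂ ((degreeLT ℂ d).map (krylovMap A w)) ≤ d := by
  have : Module.Finite ℂ (degreeLT ℂ d) := Module.Finite.equiv (degreeLTEquiv ℂ d).symm
  refine (Submodule.finrank_map_le _ _).trans (le_of_eq ?_)
  rw [(degreeLTEquiv ℂ d).finrank_eq, Module.finrank_fin_fun]

/-- A dimension count replaces partial fractions: the independent family already has as many members
as the polynomial space has dimensions. -/
theorem span_arnoldiVectors (A : Matrix (Fin n) (Fin n) ℂ) (w : Fin n → ℂ) (κ₀ : ℕ)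
    (lam : Fin m → ℂ) (κ : Fin m → ℕ) (hlam : ∀ k, lam k ∉ spectrum ℂ A)
    (hindep : LinearIndependent ℂ
      (arnoldiVectors A (aeval A (nodePolynomial lam κ) *ᵥ w) κ₀ lam κ)) :
    Submodule.span ℂ (Set.range
        (arnoldiVectors A (aeval A (nodePolynomial lam κ) *ᵥ w) κ₀ lam κ)) =
      (degreeLT ℂ (κ₀ + ∑ k, κ k)).map (krylovMap A w) := by
  refine Submodule.eq_of_le_of_finrank_le (Submodule.span_le.2 ?_) ?_
  · rintro _ ⟨i, rfl⟩
    exact arnoldiVectors_mem_krylov A w κ₀ lam κ hlam i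
  · rw [finrank_span_eq_card hindep]
    simpa using finrank_degreeLT_map_le A w (κ₀ + ∑ k, κ k)

theorem finrank_range_of_conjTranspose_mul_self {V : Matrix (Fin n) (Fin N) ℂ}
    (hV : Vᴴ * V = 1) : Module.finrank ℂ (LinearMap.range V.mulVecLin) = N := by
  rw [LinearMap.finrank_range_of_inj, Module.finrank_fin_fun]
  refine Function.LeftInverse.injective (g := fun x => Vᴴ *ᵥ x) fun x => ?_
  beta_reduce
  rw [Matrix.mulVecLin_apply, Matrix.mulVec_mulVec, hV, Matrix.one_mulVec]

theorem mulVec_conjTranspose_mulVec_of_mem_range {V : Matrix (Fin n) (Fin N) ℂ}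
    (hV : Vᴴ * V = 1) {x : Fin n → ℂ} (hx : x ∈ LinearMap.range V.mulVecLin) :
    V *ᵥ (Vᴴ *ᵥ x) = x := by
  obtain ⟨y, rfl⟩ := hx
  rw [Matrix.mulVecLin_apply, Matrix.mulVec_mulVec y Vᴴ, hV, Matrix.one_mulVec]

/-- Each new power meets one factor `V Vᴴ`, which is the identity on the range of `V`. -/
theorem pow_mulVec_of_krylov {A : Matrix (Fin n) (Fin n) ℂ} {V : Matrix (Fin n) (Fin N) ℂ}
    (hV : Vᴴ * V = 1) {w : Fin n → ℂ}
    (hw : ∀ j < N, (A ^ j) *ᵥ w ∈ LinearMap.range V.mulVecLin) {j : ℕ} (hj : j < N) :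
    V *ᵥ (((Vᴴ * A * V) ^ j) *ᵥ (Vᴴ *ᵥ w)) = (A ^ j) *ᵥ w := by
  induction j with
  | zero =>
    simpa using mulVec_conjTranspose_mulVec_of_mem_range hV (by simpa using hw 0 hj)
  | succ j ih =>
    rw [← mulVec_conjTranspose_mulVec_of_mem_range hV (hw _ hj), pow_succ' A,
      ← Matrix.mulVec_mulVec (M := A), ← ih (by omega), pow_succ']
    simp only [Matrix.mulVec_mulVec, Matrix.mul_assoc]

theorem aeval_mulVec_of_krylov {A : Matrix (Fin n) (Fin n) ℂ} {V : Matrix (Fin n) (Fin N) ℂ}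
    (hV : Vᴴ * V = 1) {w : Fin n → ℂ}
    (hw : ∀ j < N, (A ^ j) *ᵥ w ∈ LinearMap.range V.mulVecLin) {p : ℂ[X]} (hp : p.degree < N) :
    V *ᵥ (aeval (Vᴴ * A * V) p *ᵥ (Vᴴ *ᵥ w)) = aeval A p *ᵥ w := by
  by_cases h0 : p = 0
  · simp [h0]
  have hp' : p.natDegree < N := by
    rw [degree_eq_natDegree h0] at hp
    exact_mod_cast hp
  simp only [aeval_eq_sum_range' hp', Matrix.sum_mulVec, Matrix.smul_mulVec, Matrix.mulVec_sum,
    Matrix.mulVec_smul]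
  exact Finset.sum_congr rfl fun j hj => by
    rw [pow_mulVec_of_krylov hV hw (Finset.mem_range.1 hj)]

/-- Degree `N` is allowed here: after `Vᴴ` is applied, the last product by `A` may leave the range
of `V`. This covers `v` when `κ₀ = 0`. -/
theorem conjTranspose_aeval_mulVec_of_krylov {A : Matrix (Fin n) (Fin n) ℂ}
    {V : Matrix (Fin n) (Fin N) ℂ} (hV : Vᴴ * V = 1) {w : Fin n → ℂ}
    (hw : ∀ j < N, (A ^ j) *ᵥ w ∈ LinearMap.range V.mulVecLin) {p : ℂ[X]}
    (hp : p.natDegree ≤ N) :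
    Vᴴ *ᵥ (aeval A p *ᵥ w) = aeval (Vᴴ * A * V) p *ᵥ (Vᴴ *ᵥ w) := by
  rw [aeval_eq_sum_range' (Nat.lt_succ_of_le hp), aeval_eq_sum_range' (Nat.lt_succ_of_le hp)]
  simp only [Matrix.sum_mulVec, Matrix.smul_mulVec, Matrix.mulVec_sum, Matrix.mulVec_smul]
  refine Finset.sum_congr rfl fun j hj => ?_
  congr 1
  rcases j with _ | j
  · simp
  · have hj' : j < N := by
      have := Finset.mem_range.1 hj
      omega
    rw [pow_succ' A, ← Matrix.mulVec_mulVec (M := A), ← pow_mulVec_of_krylov hV hw hj', pow_succ']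
    simp only [Matrix.mulVec_mulVec, Matrix.mul_assoc]

theorem nodePolynomial_eq_charpoly {M : Matrix (Fin N) (Fin N) ℂ} {p : Fin m → ℂ}
    (hp : Function.Injective p) (hrange : Set.range p = spectrum ℂ M) {w : Fin m → ℕ}
    (hw : ∀ k, w k = M.charpoly.rootMultiplicity (p k)) : nodePolynomial p w = M.charpoly := by
  classical
  rw [(IsAlgClosed.splits M.charpoly).eq_prod_roots_of_monic M.charpoly_monic,
    prod_multiset_root_eq_finset_root]
  have : M.charpoly.roots.toFinset = Finset.univ.image p := by
    ext z
    rw [Multiset.mem_toFinset, mem_roots M.charpoly_monic.ne_zero,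
      ← Matrix.mem_spectrum_iff_isRoot_charpoly, ← hrange]
    simp
  rw [this, Finset.prod_image fun _ _ _ _ h => hp h, nodePolynomial]
  simp only [hw]

end RationalKrylov

/-! ### From matrix functions to the bound term -/

section ErrorBound

open Polynomial

variable {n : ℕ}

theorem exists_iteratedDeriv_polynomial_mul_exp (p : ℂ[X]) (t : ℂ) (k : ℕ) :
    ∃ q : ℂ[X], iteratedDeriv k (fun z => p.eval z * Complex.exp (t * z)) =
      fun z => q.eval z * Complex.exp (t * z) := by
  induction k with
  | zero => exact ⟨p, iteratedDeriv_zero⟩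
  | succ k ih =>
    obtain ⟨q, hq⟩ := ih
    refine ⟨derivative q + C t * q, ?_⟩
    rw [iteratedDeriv_succ, hq]
    ext z
    have h := (q.hasDerivAt z).mul (((hasDerivAt_id z).const_mul t).cexp)
    refine (HasDerivAt.deriv h).trans ?_
    simp
    ring

open scoped Matrix.Norms.Operator in
theorem exp_smul_one_add (A : Matrix (Fin n) (Fin n) ℂ) (c : ℂ) :
    NormedSpace.exp (c • (1 : Matrix (Fin n) (Fin n) ℂ) + A) =
      Complex.exp c • NormedSpace.exp A := by
  rw [Matrix.exp_add_of_commute _ _ ((Commute.one_left A).smul_left c),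
    ← Algebra.algebraMap_eq_smul_one, Complex.exp_eq_exp_ℂ]
  refine (congrArg (· * NormedSpace.exp A) (NormedSpace.algebraMap_exp_comm (𝕂 := ℂ)
    (𝔸 := Matrix (Fin n) (Fin n) ℂ) c).symm).trans ?_
  rw [Algebra.algebraMap_eq_smul_one, Matrix.smul_mul, one_mul]

/-- The two sides use different circles. For a polynomial times an exponential both have closed
forms, so no contour deformation is needed. -/
theorem entireMatrixFunction_affine (A : Matrix (Fin n) (Fin n) ℂ) (p : ℂ[X]) (t a s : ℂ) :
    entireMatrixFunction (fun z => p.eval (a + s * z) * Complex.exp (t * (a + s * z))) A =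
      entireMatrixFunction (fun z => p.eval z * Complex.exp (t * z))
        (a • (1 : Matrix (Fin n) (Fin n) ℂ) + s • A) := by
  have h1 : (fun z => p.eval (a + s * z) * Complex.exp (t * (a + s * z))) =
      fun z => Complex.exp (t * a) * ((p.comp (C a + C s * X)).eval z *
        Complex.exp (t * s * z)) := by
    ext z
    rw [mul_add, Complex.exp_add]
    simp only [eval_comp, eval_add, eval_mul, eval_C, eval_X]
    rw [mul_assoc t s z]
    ring
  rw [h1, entireMatrixFunction_const_mul, entireMatrixFunction_polynomial_mul_exp,
    entireMatrixFunction_polynomial_mul_exp, aeval_comp, smul_add, smul_smul, smul_smul,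
    exp_smul_one_add, Matrix.mul_smul]
  simp [Algebra.algebraMap_eq_smul_one]

open scoped Matrix.Norms.Operator in
theorem continuous_entireMatrixFunction (p : ℂ[X]) (t : ℂ) :
    Continuous fun M : Matrix (Fin n) (Fin n) ℂ =>
      entireMatrixFunction (fun z => p.eval z * Complex.exp (t * z)) M := by
  simp only [entireMatrixFunction_polynomial_mul_exp]
  exact p.continuous_aeval.mul (NormedSpace.exp_continuous.comp (continuous_const_smul t))

theorem continuous_euclNorm : Continuous (euclNorm (n := n)) :=
  continuous_norm.comp (PiLp.continuous_toLp 2 _)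

/-- The vector-valued functional `h ↦ B h(A) b`. -/
noncomputable def matrixFunctional (A B : Matrix (Fin n) (Fin n) ℂ) (b : Fin n → ℂ) :
    DifferentiableFunctional (EuclideanSpace ℂ (Fin n)) where
  toFun h := WithLp.toLp 2 ((B * entireMatrixFunction h A) *ᵥ b)
  map_const_mul c h := by
    rw [entireMatrixFunction_const_mul, Matrix.mul_smul, Matrix.smul_mulVec, WithLp.toLp_smul]
  hasDerivAt {H H'} hH hH' hd r := by
    refine ((PiLp.continuousLinearEquiv 2 ℝ (fun _ : Fin n =>
      ℂ)).symm.toContinuousLinearMap.hasFDerivAt.comp_hasDerivAt r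
      (f := fun r => (B * entireMatrixFunction (H r) A) *ᵥ b) ?_)
    refine hasDerivAt_pi.2 fun i => ?_
    simp only [Matrix.mulVec, dotProduct, Matrix.mul_apply]
    exact HasDerivAt.fun_sum fun j _ => (HasDerivAt.fun_sum fun k _ =>
      (hasDerivAt_entireMatrixFunction_apply A hH hH' hd r k j).const_mul (B i k)).mul_const (b j)

theorem arnoldiBoundTerm_eq (A : Matrix (Fin n) (Fin n) ℂ) (b : Fin n → ℂ) (Om v : ℂ[X])
    (N : ℕ) (t s : ℝ) (μ : ℂ) :
    arnoldiBoundTerm A b Om v N t s μ =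
      ‖(matrixFunctional A (aeval A Om * (aeval A v)⁻¹) b).toFun (fun z =>
        iteratedDeriv N (fun z => v.eval z * Complex.exp (t * z)) ((1 - s) * μ + s * z))‖ /
        N.factorial := by
  obtain ⟨q, hq⟩ := exists_iteratedDeriv_polynomial_mul_exp v t N
  rw [arnoldiBoundTerm, hq, matrixFunctional]
  dsimp only
  rw [entireMatrixFunction_affine, Matrix.mul_smul, Matrix.smul_mulVec, euclNorm,
    WithLp.toLp_smul, norm_smul, norm_inv, Complex.norm_natCast, inv_mul_eq_div]

theorem continuous_arnoldiBoundTerm (A : Matrix (Fin n) (Fin n) ℂ) (b : Fin n → ℂ)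
    (Om v : ℂ[X]) (N : ℕ) (t : ℝ) :
    Continuous fun x : ℝ × ℂ => arnoldiBoundTerm A b Om v N t x.1 x.2 := by
  obtain ⟨q, hq⟩ := exists_iteratedDeriv_polynomial_mul_exp v t N
  simp only [arnoldiBoundTerm, hq]
  refine continuous_euclNorm.comp (Continuous.matrix_mulVec ?_ continuous_const)
  have hM : Continuous fun x : ℝ × ℂ =>
      ((1 - (x.1 : ℂ)) * x.2) • (1 : Matrix (Fin n) (Fin n) ℂ) + (x.1 : ℂ) • A := by fun_prop
  exact continuous_const.mul
    (((continuous_entireMatrixFunction q t).comp hM).const_smul (N.factorial : ℂ)⁻¹)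

theorem exists_isGreatest_arnoldiBoundTerm (A : Matrix (Fin n) (Fin n) ℂ) (b : Fin n → ℂ)
    (Om v : ℂ[X]) (N : ℕ) (t : ℝ) {K : Set ℂ} (hK : IsCompact K) (hne : K.Nonempty) :
    ∃ C : ℝ, IsGreatest {c : ℝ | ∃ s ∈ Set.Icc (0 : ℝ) 1, ∃ μ ∈ K,
      c = arnoldiBoundTerm A b Om v N t s μ} C := by
  obtain ⟨x, hx, hmax⟩ := ((isCompact_Icc (a := (0 : ℝ)) (b := 1)).prod hK).exists_isMaxOn
    ((Set.nonempty_Icc.2 zero_le_one).prod hne)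
    (continuous_arnoldiBoundTerm A b Om v N t).continuousOn
  refine ⟨arnoldiBoundTerm A b Om v N t x.1 x.2, ⟨x.1, hx.1, x.2, hx.2, rfl⟩, ?_⟩
  rintro _ ⟨s, hs, μ, hμ, rfl⟩
  exact isMaxOn_iff.1 hmax (s, μ) ⟨hs, hμ⟩

theorem entireMatrixFunction_eq_of_interpolation (M : Matrix (Fin n) (Fin n) ℂ) {f g : ℂ → ℂ}
    (hg : Differentiable ℂ g) {p q : ℂ[X]} (hf : ∀ z, f z = p.eval z + q.eval z * g z) :
    entireMatrixFunction f M = aeval M p + aeval M q * entireMatrixFunction g M := by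
  rw [funext hf, entireMatrixFunction_add M (h := fun z => q.eval z * g z) p.continuous
      (q.continuous.mul hg.continuous),
    entireMatrixFunction_polynomial, entireMatrixFunction_polynomial_mul M q hg]

theorem exp_mulVec_aeval_mulVec (M : Matrix (Fin n) (Fin n) ℂ) (v : ℂ[X]) (t : ℂ)
    (x : Fin n → ℂ) :
    NormedSpace.exp (t • M) *ᵥ (aeval M v *ᵥ x) =
      entireMatrixFunction (fun z => v.eval z * Complex.exp (t * z)) M *ᵥ x := by
  have hc : Commute (NormedSpace.exp (t • M)) (aeval M v) := by
    rw [← entireMatrixFunction_exp]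
    refine entireMatrixFunction_commute M _ ?_ (by fun_prop)
    simpa using (Commute.all X v).map (aeval M)
  rw [entireMatrixFunction_polynomial_mul_exp, Matrix.mulVec_mulVec, hc.eq]

end ErrorBound

/-! ### The error estimate -/

theorem theoremt {n nhat m mhat : ℕ} (hnhat : 0 < nhat)
    (A : Matrix (Fin n) (Fin n) ℂ) (b : Fin n → ℂ)
    (κ₀ : ℕ) (lam : Fin m → ℂ) (κ : Fin m → ℕ)
    (hlam : ∀ k, lam k ∉ spectrum ℂ A)
    (V : Matrix (Fin n) (Fin nhat) ℂ) (hV : Vᴴ * V = 1)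
    (hindep : LinearIndependent ℂ (arnoldiVectors A b κ₀ lam κ))
    (hspan : Submodule.span ℂ (Set.range (arnoldiVectors A b κ₀ lam κ)) =
      LinearMap.range V.mulVecLin)
    (Ahat : Matrix (Fin nhat) (Fin nhat) ℂ) (hAhat : Ahat = Vᴴ * A * V)
    (bhat : Fin nhat → ℂ) (hbhat : bhat = Vᴴ *ᵥ b)
    (muhat : Fin mhat → ℂ) (hmu_inj : Function.Injective muhat)
    (hmu : Set.range muhat = spectrum ℂ Ahat)
    (what : Fin mhat → ℕ) (hwhat : ∀ k, what k = Ahat.charpoly.rootMultiplicity (muhat k))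
    (t : ℝ) :
    ∃ C : ℝ,
      IsGreatest
        {c : ℝ | ∃ s ∈ Set.Icc (0 : ℝ) 1, ∃ μ ∈ convexHull ℝ (Set.range muhat),
          c = arnoldiBoundTerm A b (nodePolynomial muhat what) (nodePolynomial lam κ) nhat t s μ} C ∧
      euclNorm (NormedSpace.exp ((t : ℂ) • A) *ᵥ b -
        V *ᵥ (NormedSpace.exp ((t : ℂ) • Ahat) *ᵥ bhat)) ≤ C := by
  have hOm := nodePolynomial_eq_charpoly hmu_inj hmu hwhat
  set v := nodePolynomial lam κ with hv
  -- Interpolation nodes: the eigenvalues repeated by multiplicity, hence exactly `nhat` of them.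
  set l := Ahat.charpoly.roots.toList with hl
  have hlen : l.length = nhat := by
    rw [hl, Multiset.length_toList, IsAlgClosed.card_roots_eq_natDegree,
      Matrix.charpoly_natDegree_eq_dim, Fintype.card_fin]
  have hprod : (l.map fun c => Polynomial.X - Polynomial.C c).prod = Ahat.charpoly := by
    conv_rhs => rw [(IsAlgClosed.splits Ahat.charpoly).eq_prod_roots_of_monic Ahat.charpoly_monic]
    rw [← Multiset.prod_coe, ← Multiset.map_coe, hl, Multiset.coe_toList]
  have hlmem : ∀ c ∈ l, c ∈ convexHull ℝ (Set.range muhat) := fun c hc => by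
    refine subset_convexHull ℝ _ ?_
    rw [hmu, Matrix.mem_spectrum_iff_isRoot_charpoly]
    exact Polynomial.isRoot_of_mem_roots (Multiset.mem_toList.1 hc)
  have hne : (convexHull ℝ (Set.range muhat)).Nonempty := by
    obtain ⟨c, hc⟩ := List.exists_mem_of_length_pos (hlen ▸ hnhat)
    exact ⟨c, hlmem c hc⟩
  obtain ⟨C, hC⟩ := exists_isGreatest_arnoldiBoundTerm A b (nodePolynomial muhat what) v nhat t
    ((Set.finite_range muhat).isCompact_convexHull ℝ) hne
  refine ⟨C, hC, ?_⟩
  have hunit := (Matrix.isUnit_iff_isUnit_det _).1 (isUnit_aeval_nodePolynomial A lam κ hlam)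
  rw [← hv] at hunit
  set w := (Polynomial.aeval A v)⁻¹ *ᵥ b with hw
  have hb : b = Polynomial.aeval A v *ᵥ w := by
    rw [hw, Matrix.mulVec_mulVec, Matrix.mul_nonsing_inv _ hunit, Matrix.one_mulVec]
  have hdim : κ₀ + ∑ k, κ k = nhat := by
    rw [← finrank_range_of_conjTranspose_mul_self hV, ← hspan, finrank_span_eq_card hindep]
    simp
  have hkry : (Polynomial.degreeLT ℂ nhat).map (krylovMap A w) = LinearMap.range V.mulVecLin := by
    rw [← hspan, ← hdim]
    rw [hb] at hindep
    conv_rhs => rw [hb]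
    exact (span_arnoldiVectors A w κ₀ lam κ hlam hindep).symm
  have hpow : ∀ j < nhat, (A ^ j) *ᵥ w ∈ LinearMap.range V.mulVecLin := fun j hj => by
    rw [← hkry]
    refine ⟨Polynomial.X ^ j, ?_, by simp [krylovMap]⟩
    rw [SetLike.mem_coe, Polynomial.mem_degreeLT, Polynomial.degree_X_pow]
    exact_mod_cast hj
  -- Uses `deg v = ∑ κ k ≤ nhat`, which follows from `hdim`.
  have hbhat' : bhat = Polynomial.aeval Ahat v *ᵥ (Vᴴ *ᵥ w) := by
    rw [hbhat, hAhat, ← conjTranspose_aeval_mulVec_of_krylov hV hpow, ← hb]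
    rw [hv, natDegree_nodePolynomial]
    omega
  set f : ℂ → ℂ := fun z => v.eval z * Complex.exp (t * z) with hf
  have hfd : Differentiable ℂ f := by fun_prop
  have hgd := hfd.dividedDifference l
  obtain ⟨p, hp, hpf⟩ := exists_interpolation f l
  rw [hlen] at hp
  have herr : NormedSpace.exp ((t : ℂ) • A) *ᵥ b -
      V *ᵥ (NormedSpace.exp ((t : ℂ) • Ahat) *ᵥ bhat) =
      (Polynomial.aeval A (nodePolynomial muhat what) * (Polynomial.aeval A v)⁻¹ *
        entireMatrixFunction (dividedDifference f l) A) *ᵥ b := by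
    have hcomm : Commute (Polynomial.aeval A v)⁻¹
        (entireMatrixFunction (dividedDifference f l) A) := by
      refine Commute.nonsing_inv_left (entireMatrixFunction_commute A _ ?_ hgd.continuous).symm
      simpa using (Commute.all Polynomial.X v).map (Polynomial.aeval A)
    rw [hbhat', exp_mulVec_aeval_mulVec]
    conv_lhs => rw [hb]
    rw [exp_mulVec_aeval_mulVec, ← hf, entireMatrixFunction_eq_of_interpolation A hgd hpf,
      entireMatrixFunction_eq_of_interpolation Ahat hgd hpf, hprod, Matrix.aeval_self_charpoly,
      zero_mul, add_zero, hAhat, aeval_mulVec_of_krylov hV hpow hp, ← hAhat, Matrix.add_mulVec,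
      add_sub_cancel_left, hOm, mul_assoc, hcomm.eq, hw, Matrix.mulVec_mulVec, mul_assoc]
  rw [herr]
  have hbound := (matrixFunctional A (Polynomial.aeval A (nodePolynomial muhat what) *
    (Polynomial.aeval A v)⁻¹) b).norm_dividedDifference_le (convex_convexHull ℝ _) hne l hlmem hfd
    -- The bound term already contains `1 / nhat!`, so the undivided derivative is bounded by `C *
    -- nhat!`.
    (C := C * nhat.factorial) fun s hs μ hμ => by
      have := hC.2 ⟨s, hs, μ, hμ, rfl⟩
      rw [arnoldiBoundTerm_eq, div_le_iff₀ (by positivity)] at this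
      rwa [hlen]
  rwa [hlen, mul_div_cancel_right₀ _ (Nat.cast_ne_zero.2 nhat.factorial_ne_zero)] at hbound
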